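/- Work in the 2-category $\mathbf{2Hilb}$ of finite-dimensional 2-Hilbert spaces in matrix form: objects are natural numbers $n$ (standing for $\mathbf{Hilb}^n$), 1-cells $m\to n$ are $m\times n$ matrices of finite-dimensional complex Hilbert spaces (composed by the matrix product with $\oplus$ and $\otimes$, written in left-to-right order, with rows indexing the source), 2-cells are matrices of linear maps, and $\dagger$ takes entrywise adjoints. A 2-cell $\mu$ is (vertically) unitary if $\mu^\dagger\mu=\mathrm{id}$ and $\mu\mu^\dagger=\mathrm{id}$. The adjoint $F^*$ of a 1-cell $F$ is the transposed matrix of dual Hilbert spaces, with cups given by the vectors $\sum_k e_k\otimes e_k^*$ and caps by their adjoints. A 2-cell $f: H\circ J\Rightarrow F\circ G$ is horizontally unitary if the 2-cell $F^*\circ H\Rightarrow G\circ J^*$, obtained by bending the leg $F$ down to the left and the leg $J$ up to the right with these cups and caps, is unitary. Let $n$ be a natural number and $H$ a finite-dimensional Hilbert space. Let $W_L: 1\to n$ and $W_R: n\to 1$ be the 1-cells all of whose entries are $\mathbb C$ (the left and right boundaries of a region of $n$-valued classical data), let $\mathrm{Copy}:\mathrm{id}_n\Rightarrow W_R\circ W_L$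 be the 2-cell with diagonal entries $1$, and let $\mathrm{Create}:\mathrm{id}_1\Rightarrow W_L\circ W_R$ be the vector $(1,\dots,1)\in\mathbb C^n$. A controlled operation is a 2-cell $U: W_R\circ H\Rightarrow W_R\circ H$ and a (bipartite, nondegenerate) measurement is a unitary 2-cell $M: H\circ H^*\Rightarrow W_L\circ W_R$. Suppressing the structural isomorphisms, and writing $\mathrm{Bell}:\mathrm{id}_1\Rightarrow H\circ H^*$ and $\mathrm{Bell}':\mathrm{id}_1\Rightarrow H^*\circ H$ for the (unnormalised) cups, unitary $M$ and $U$ form a solution of the dense-coding specification if $$\tfrac1{\sqrt{\dim H}}\,(W_R\circ M)\cdot(U\circ H^*)\cdot(W_R\circ \mathrm{Bell})=\mathrm{Copy}\circ W_R ,$$ and a solution of the teleportation specification if $$(W_L\circ U)\cdot(M\circ H)\cdot(H\circ \mathrm{Bell}')=\tfrac1{\sqrt{\dim H}}\,(\mathrm{Create}\circ H).$$ Theorem. Let $U$ be a vertically unitary controlled operation. (i) There is a measurement $M$ such that $(M,U)$ is a solution of the dense-coding specification if and only if $U$ is horizontally unitary up to a scalar factor, i.e. $cU$ is horizontally unitary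 for some $c\in\mathbb C\setminus\{0\}$. (ii) For every $M$, the pair $(M,U)$ is a solution of the teleportation specification if and only if it is a solution of the dense-coding specification; so implementations of teleportation and implementations of dense coding are the same data. -/

import Mathlib

open scoped TensorProduct

noncomputable section

namespace TwoHilb

/-! ### Finite-dimensional Hilbert spaces -/

/-- A finite-dimensional complex Hilbert space. -/
structure FdHilb : Type 1 where
  carrier : Type
  [normed : NormedAddCommGroup carrier]
  [hilbert : InnerProductSpace ℂ carrier]
  [finite : FiniteDimensional ℂ carrier]

attribute [instance] FdHilb.normed FdHilb.hilbert FdHilb.finite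

instance : CoeSort FdHilb Type := ⟨FdHilb.carrier⟩

/-- The Hilbert space structure on the dual of a finite-dimensional Hilbert space,
`⟪⟪x, ·⟫, ⟪y, ·⟫⟫ = ⟪y, x⟫`; its norm is the operator norm. -/
instance dualInner (E : Type) [NormedAddCommGroup E] [InnerProductSpace ℂ E]
    [FiniteDimensional ℂ E] : InnerProductSpace ℂ (StrongDual ℂ E) :=
  letI : CompleteSpace E := FiniteDimensional.complete ℂ E
  { inner := fun f g => inner ℂ ((InnerProductSpace.toDual ℂ E).symm g)
      ((InnerProductSpace.toDual ℂ E).symm f)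
    norm_sq_eq_re_inner := fun f => by
      rw [← norm_sq_eq_re_inner (𝕜 := ℂ) ((InnerProductSpace.toDual ℂ E).symm f),
        LinearIsometryEquiv.norm_map]
    conj_inner_symm := fun f g => inner_conj_symm _ _
    add_left := fun f g h => by rw [map_add, inner_add_right]
    smul_left := fun f g r => by rw [LinearIsometryEquiv.map_smulₛₗ, inner_smul_right] }

namespace FdHilb

/-- The dual Hilbert space `H*`. -/
def dual (H : FdHilb) : FdHilb := ⟨StrongDual ℂ H⟩

/-- The Hilbert space `ℂ`. -/
def scalar : FdHilb := ⟨ℂ⟩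

/-- The unit vector of `ℂ`. -/
def unitVec : scalar := (1 : ℂ)

/-- The Hilbert space `ℂ` if `P` holds, and the zero space (functions on an empty type) if not. -/
def indicator (P : Prop) [Decidable P] : FdHilb := ⟨EuclideanSpace ℂ (PLift P)⟩

/-- The unit vector of `indicator P` when `P` holds. -/
def indicatorVec {P : Prop} [Decidable P] (h : P) : indicator P :=
  EuclideanSpace.single (PLift.up h) (1 : ℂ)

/-- The coordinate of a vector of `indicator P` when `P` holds. -/
def indicatorCoord {P : Prop} [Decidable P] (h : P) : indicator P →ₗ[ℂ] ℂ :=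
  PiLp.projₗ (𝕜 := ℂ) 2 (fun _ : PLift P => ℂ) (PLift.up h)

/-- The direct sum of a finite family of Hilbert spaces. -/
def directSum {n : ℕ} (A : Fin n → FdHilb) : FdHilb := ⟨PiLp 2 fun j => A j⟩

/-- Inclusion of the `j`-th summand. -/
def incl {n : ℕ} (A : Fin n → FdHilb) (j : Fin n) : A j →ₗ[ℂ] directSum A :=
  (WithLp.linearEquiv 2 ℂ (∀ j, A j)).symm.toLinearMap ∘ₗ LinearMap.single ℂ (fun j => A j) j

/-- Projection to the `j`-th summand. -/
def proj {n : ℕ} (A : Fin n → FdHilb) (j : Fin n) : directSum A →ₗ[ℂ] A j :=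
  PiLp.projₗ (𝕜 := ℂ) 2 (fun j => A j) j

/-- The tensor product of Hilbert spaces. -/
def tensor (A B : FdHilb) : FdHilb := ⟨A ⊗[ℂ] B⟩

/-- Pure tensors, as a bilinear map. -/
def tmul (A B : FdHilb) : A →ₗ[ℂ] B →ₗ[ℂ] tensor A B := TensorProduct.mk ℂ A B

/-- The linear map out of a tensor product given by a bilinear map. -/
def tensorLift {A B C : FdHilb} (f : A →ₗ[ℂ] B →ₗ[ℂ] C) : tensor A B →ₗ[ℂ] C :=
  TensorProduct.lift f

/-- The tensor product of linear maps. -/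
def tensorMap {A A' B B' : FdHilb} (f : A →ₗ[ℂ] A') (g : B →ₗ[ℂ] B') :
    tensor A B →ₗ[ℂ] tensor A' B' := TensorProduct.map f g

/-- The associativity isomorphism `(A ⊗ B) ⊗ C ≃ A ⊗ (B ⊗ C)`. -/
def tensorAssoc (A B C : FdHilb) :
    tensor (tensor A B) C ≃ₗ[ℂ] tensor A (tensor B C) := TensorProduct.assoc ℂ A B C

/-- The maximally entangled (Bell) vector `∑ₖ eₖ ⊗ ⟪eₖ, ·⟫` of `H ⊗ H*`, not normalised;
it does not depend on the orthonormal basis `e`. -/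
def bell (H : FdHilb) : tensor H H.dual :=
  ∑ k, tmul H H.dual (stdOrthonormalBasis ℂ H k)
    (InnerProductSpace.toDualMap ℂ H (stdOrthonormalBasis ℂ H k))

/-- The same vector with the two tensor factors exchanged, `∑ₖ ⟪eₖ, ·⟫ ⊗ eₖ` in `H* ⊗ H`. -/
def bell' (H : FdHilb) : tensor H.dual H :=
  ∑ k, tmul H.dual H (InnerProductSpace.toDualMap ℂ H (stdOrthonormalBasis ℂ H k))
    (stdOrthonormalBasis ℂ H k)

end FdHilb

open FdHilb

/-! ### The 2-category of finite-dimensional 2-Hilbert spaces, in matrix form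

Objects are natural numbers, `n` standing for `Hilbⁿ`; the monoidal unit is `1`.
A 1-cell is a matrix of finite-dimensional Hilbert spaces and a 2-cell is a matrix of linear maps.
Composites of 1-cells are written in diagrammatic order: rows index the source (the region to the
left of the line) and columns index the target (the region to the right). -/

/-- 1-cells `m ⟶ n`. -/
abbrev Cell1 (m n : ℕ) : Type 1 := Fin m → Fin n → FdHilb

/-- 2-cells `F ⟹ G`. -/
abbrev Cell2 {m n : ℕ} (F G : Cell1 m n) : Type := ∀ i j, F i j →ₗ[ℂ] G i j

variable {m n p q : ℕ}

/-- The identity 2-cell. -/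
def id₂ (F : Cell1 m n) : Cell2 F F := fun _ _ => LinearMap.id

/-- Vertical composition: first `α`, then `β`. -/
def vcomp {F G K : Cell1 m n} (α : Cell2 F G) (β : Cell2 G K) : Cell2 F K :=
  fun i j => β i j ∘ₗ α i j

/-- The reversal `†` of 2-cells: entrywise Hilbert space adjoint. -/
def dagger {F G : Cell1 m n} (α : Cell2 F G) : Cell2 G F :=
  fun i j => LinearMap.adjoint (α i j)

/-- (Vertical) unitarity of a 2-cell. -/
def IsUnitary {F G : Cell1 m n} (α : Cell2 F G) : Prop :=
  vcomp α (dagger α) = id₂ F ∧ vcomp (dagger α) α = id₂ G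

/-- Composition of 1-cells: the matrix product, with direct sum and tensor product in place of
sum and product. -/
def comp (F : Cell1 m n) (G : Cell1 n p) : Cell1 m p :=
  fun i k => directSum fun j => tensor (F i j) (G j k)

/-- Inclusion of the `j`-th summand of an entry of a composite 1-cell. -/
def inclC (F : Cell1 m n) (G : Cell1 n p) (i : Fin m) (k : Fin p) (j : Fin n) :
    tensor (F i j) (G j k) →ₗ[ℂ] comp F G i k :=
  incl (fun j => tensor (F i j) (G j k)) j

/-- Projection to the `j`-th summand of an entry of a composite 1-cell. -/
def projC (F : Cell1 m n) (G : Cell1 n p) (i : Fin m) (k : Fin p) (j : Fin n) :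
    comp F G i k →ₗ[ℂ] tensor (F i j) (G j k) :=
  proj (fun j => tensor (F i j) (G j k)) j

/-- Horizontal composition of 2-cells. -/
def hcomp {F F' : Cell1 m n} {G G' : Cell1 n p} (α : Cell2 F F') (β : Cell2 G G') :
    Cell2 (comp F G) (comp F' G') :=
  fun i k => ∑ j, inclC F' G' i k j ∘ₗ tensorMap (α i j) (β j k) ∘ₗ projC F G i k j

/-- Whiskering: the 1-cell `F` placed to the left of the 2-cell `β`. -/
def wl (F : Cell1 m n) {G G' : Cell1 n p} (β : Cell2 G G') : Cell2 (comp F G) (comp F G') :=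
  hcomp (id₂ F) β

/-- Whiskering: the 1-cell `G` placed to the right of the 2-cell `α`. -/
def wr {F F' : Cell1 m n} (α : Cell2 F F') (G : Cell1 n p) : Cell2 (comp F G) (comp F' G) :=
  hcomp α (id₂ G)

/-- The associator `(F ∘ G) ∘ K ⟹ F ∘ (G ∘ K)`. -/
def assoc (F : Cell1 m n) (G : Cell1 n p) (K : Cell1 p q) :
    Cell2 (comp (comp F G) K) (comp F (comp G K)) :=
  fun i l => ∑ j, ∑ k,
    inclC F (comp G K) i l j ∘ₗ tensorMap LinearMap.id (inclC G K j l k) ∘ₗ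
      (tensorAssoc (F i j) (G j k) (K k l)).toLinearMap ∘ₗ
        tensorMap (projC F G i k j) LinearMap.id ∘ₗ projC (comp F G) K i l k

/-- The inverse associator `F ∘ (G ∘ K) ⟹ (F ∘ G) ∘ K`. -/
def assocInv (F : Cell1 m n) (G : Cell1 n p) (K : Cell1 p q) :
    Cell2 (comp F (comp G K)) (comp (comp F G) K) :=
  fun i l => ∑ j, ∑ k,
    inclC (comp F G) K i l k ∘ₗ tensorMap (inclC F G i k j) LinearMap.id ∘ₗ
      (tensorAssoc (F i j) (G j k) (K k l)).symm.toLinearMap ∘ₗ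
        tensorMap LinearMap.id (projC G K j l k) ∘ₗ projC F (comp G K) i l j

/-- The identity 1-cell: `ℂ` on the diagonal, the zero space off the diagonal. -/
abbrev id₁ (n : ℕ) : Cell1 n n := fun i j => indicator (i = j)

/-- The 2-cell out of the identity 1-cell that sends the unit vector of the `i`-th diagonal entry
to `v i`. -/
def fromId {F : Cell1 n n} (v : ∀ i, F i i) : Cell2 (id₁ n) F :=
  fun i j => if h : i = j then (indicatorCoord h).smulRight (h ▸ v i : F i j) else 0

/-- The left unitor `id ∘ F ⟹ F`, `c ⊗ x ↦ c • x`. -/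
def leftUnitor (F : Cell1 m n) : Cell2 (comp (id₁ m) F) F :=
  fun i k =>
    tensorLift (LinearMap.lsmul ℂ (F i k) ∘ₗ indicatorCoord (rfl : i = i)) ∘ₗ
      projC (id₁ m) F i k i

/-- The inverse left unitor `F ⟹ id ∘ F`, `x ↦ 1 ⊗ x`. -/
def leftUnitorInv (F : Cell1 m n) : Cell2 F (comp (id₁ m) F) :=
  fun i k => inclC (id₁ m) F i k i ∘ₗ tmul (id₁ m i i) (F i k) (indicatorVec rfl)

/-- The inverse right unitor `F ⟹ F ∘ id`, `x ↦ x ⊗ 1`. -/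
def rightUnitorInv (F : Cell1 m n) : Cell2 F (comp F (id₁ n)) :=
  fun i k => inclC F (id₁ n) i k k ∘ₗ (tmul (F i k) (id₁ n k k)).flip (indicatorVec rfl)

/-! ### Adjoint 1-cells and horizontal unitarity -/

/-- The adjoint `F*` of a 1-cell: the transposed matrix of dual Hilbert spaces. -/
abbrev adj (F : Cell1 m n) : Cell1 n m := fun j i => (F i j).dual

/-- The unit `id ⟹ F ∘ F*` of the adjunction between `F` and `F*` (a cup). -/
def cup (F : Cell1 m n) : Cell2 (id₁ m) (comp F (adj F)) :=
  fromId fun i => ∑ j, inclC F (adj F) i i j (bell (F i j))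

/-- The unit `id ⟹ F* ∘ F` of the opposite adjunction (a cup). -/
def cup' (F : Cell1 m n) : Cell2 (id₁ n) (comp (adj F) F) :=
  fromId fun j => ∑ i, inclC (adj F) F j j i (bell' (F i j))

/-- The counit `F* ∘ F ⟹ id` (a cap): the reversal of the cup `cup' F`. -/
def cap (F : Cell1 m n) : Cell2 (comp (adj F) F) (id₁ n) := dagger (cup' F)

/-- For a 2-cell `f : H ∘ J ⟹ F ∘ G`, the 2-cell `F* ∘ H ⟹ G ∘ J*` obtained by bending the
top-left leg `F` of `f` down to the left and its bottom-right leg `J` up to the right. -/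
def bend {s t : ℕ} {F : Cell1 m t} {G : Cell1 t n} {H : Cell1 m s} {J : Cell1 s n}
    (f : Cell2 (comp H J) (comp F G)) : Cell2 (comp (adj F) H) (comp G (adj J)) :=
  vcomp (rightUnitorInv (comp (adj F) H)) <|
  vcomp (wl (comp (adj F) H) (cup J)) <|
  vcomp (assoc (adj F) H (comp J (adj J))) <|
  vcomp (wl (adj F) (assocInv H J (adj J))) <|
  vcomp (wl (adj F) (wr f (adj J))) <|
  vcomp (wl (adj F) (assoc F G (adj J))) <|
  vcomp (assocInv (adj F) F (comp G (adj J))) <|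
  vcomp (wr (cap F) (comp G (adj J))) <|
  leftUnitor (comp G (adj J))

/-- Horizontal unitarity of a 2-cell `f : H ∘ J ⟹ F ∘ G`. -/
def IsHorizontallyUnitary {s t : ℕ} {F : Cell1 m t} {G : Cell1 t n} {H : Cell1 m s}
    {J : Cell1 s n} (f : Cell2 (comp H J) (comp F G)) : Prop :=
  IsUnitary (bend f)

/-! ### Classical data, controlled operations and measurements -/

/-- The witness `1 ⟶ n`, drawn as the left boundary of a region of classical data. -/
abbrev witnessL (n : ℕ) : Cell1 1 n := fun _ _ => scalar

/-- The witness `n ⟶ 1`, drawn as the right boundary of a region of classical data. -/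
abbrev witnessR (n : ℕ) : Cell1 n 1 := fun _ _ => scalar

/-- Copying of classical data: `id ⟹ witnessR ∘ witnessL`, with entry `1` on the diagonal. -/
def copy (n : ℕ) : Cell2 (id₁ n) (comp (witnessR n) (witnessL n)) :=
  fromId fun i => inclC (witnessR n) (witnessL n) i i 0 (tmul scalar scalar unitVec unitVec)

/-- Creation of uniform classical data: `id ⟹ witnessL ∘ witnessR`, that is, the vector
`(1, …, 1)` of `ℂⁿ`. -/
def create (n : ℕ) : Cell2 (id₁ 1) (comp (witnessL n) (witnessR n)) :=
  fromId fun i => ∑ j, inclC (witnessL n) (witnessR n) i i j (tmul scalar scalar unitVec unitVec)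

/-- A Hilbert space as a 1-cell `1 ⟶ 1`: a quantum system. -/
abbrev system (H : FdHilb) : Cell1 1 1 := fun _ _ => H

/-- Controlled operations on the system `H`, controlled by an `n`-valued classical datum. -/
abbrev ControlledOp (n : ℕ) (H : FdHilb) : Type :=
  Cell2 (comp (witnessR n) (system H)) (comp (witnessR n) (system H))

/-- The type of a measurement with `n` outcomes on the pair of systems `H`, `H*`. -/
abbrev BipartiteMeasurement (n : ℕ) (H : FdHilb) : Type :=
  Cell2 (comp (system H) (adj (system H))) (comp (witnessL n) (witnessR n))

/-- The normalisation factor `1 / √(dim H)` of the Bell state. -/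
def bellFactor (H : FdHilb) : ℂ := ((1 / Real.sqrt (Module.finrank ℂ H) : ℝ) : ℂ)

/-! ### Dense coding -/

/-- The dense coding protocol: prepare a Bell state to the right of a region of classical data,
apply the controlled operation to its left half, and measure both halves. -/
def denseCodingProtocol {n : ℕ} {H : FdHilb} (M : BipartiteMeasurement n H)
    (U : ControlledOp n H) :
    Cell2 (witnessR n) (comp (witnessR n) (comp (witnessL n) (witnessR n))) :=
  vcomp (rightUnitorInv (witnessR n)) <|
  vcomp (wl (witnessR n) (cup (system H))) <|
  vcomp (assocInv (witnessR n) (system H) (adj (system H))) <|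
  vcomp (wr U (adj (system H))) <|
  vcomp (assoc (witnessR n) (system H) (adj (system H))) <|
  wl (witnessR n) M

/-- Copying of the classical data bounded by the right witness. -/
def copyWitness (n : ℕ) :
    Cell2 (witnessR n) (comp (witnessR n) (comp (witnessL n) (witnessR n))) :=
  vcomp (leftUnitorInv (witnessR n)) <|
  vcomp (wr (copy n) (witnessR n)) <|
  assoc (witnessR n) (witnessL n) (witnessR n)

/-- `(M, U)` is a solution of the dense coding specification: both vertices are unitary and
the protocol, performed with the normalised Bell state, copies the classical data. -/
def SolvesDenseCoding {n : ℕ} {H : FdHilb} (M : BipartiteMeasurement n H)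
    (U : ControlledOp n H) : Prop :=
  IsUnitary M ∧ IsUnitary U ∧ bellFactor H • denseCodingProtocol M U = copyWitness n

/-! ### Teleportation -/

/-- The teleportation protocol (with unnormalised Bell state): prepare a Bell state to the right
of the system `H`, measure the system and the left half, and apply the controlled operation to
the right half. -/
def teleportationProtocol {n : ℕ} {H : FdHilb} (M : BipartiteMeasurement n H)
    (U : ControlledOp n H) :
    Cell2 (system H) (comp (witnessL n) (comp (witnessR n) (system H))) :=
  vcomp (rightUnitorInv (system H)) <|
  vcomp (wl (system H) (cup' (system H))) <|
  vcomp (assocInv (system H) (adj (system H)) (system H)) <|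
  vcomp (wr M (system H)) <|
  vcomp (assoc (witnessL n) (witnessR n) (system H)) <|
  wl (witnessL n) U

/-- Creation of uniform classical data next to the undisturbed system `H`. -/
def createBeside (n : ℕ) (H : FdHilb) :
    Cell2 (system H) (comp (witnessL n) (comp (witnessR n) (system H))) :=
  vcomp (leftUnitorInv (system H)) <|
  vcomp (wr (create n) (system H)) <|
  assoc (witnessL n) (witnessR n) (system H)

/-- `(M, U)` is a solution of the teleportation specification. -/
def SolvesTeleportation {n : ℕ} {H : FdHilb} (M : BipartiteMeasurement n H)
    (U : ControlledOp n H) : Prop :=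
  IsUnitary M ∧ IsUnitary U ∧
    teleportationProtocol M U = bellFactor H • createBeside n H

end TwoHilb

end

noncomputable section

namespace TwoHilb

open FdHilb

variable {m n p q : ℕ}

/-! ### Tensor products, duals and direct sums on vectors. -/

namespace FdHilb

/-! All three conditions reduce to one statement about vectors of H ⊗ H*. A controlled operation is
a family of maps u_i on H (`branch`), isometric since U is unitary; put β_i = (u_i ⊗ 1) Bell
(`bellOf`), let ω_i be the outcome basis of ℂⁿ and b = 1/√(dim H).

Dense coding, evaluated on the unit vector of each row, says b M β_i = ω_i for all i
(`denseCoding_iff`). Teleportation, compared outcome by outcome, says that contracting M†ω_j with x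
⊗ Bell' and then applying u_j gives b x (`teleportation_iff`). Because the vectors u_j e_k form an
orthonormal basis, this determines every coefficient of M†ω_j and amounts to b β_j = M†ω_j
(`sum_inner_smul_eq_iff`). As M is unitary, the two conditions agree for each j separately.

Bending U gives the map that sends the j-th basis vector to β_j (`bend_dualOutcome`). Hence a dense
coding solution makes the bend of bU equal to M† up to an identification of outcome bases, which is
unitary. Conversely, if the bend of cU is unitary, its adjoint is a measurement with c in place of
b. Since ‖β_i‖² = dim H, the scalars c and b have the same modulus (`exists_phase`), and a phase in
M corrects the difference. The degenerate cases n = 0 and dim H = 0 only affect the choice of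
scalars. -/

theorem inner_tmul {A B : FdHilb} (a a' : A) (b b' : B) :
    inner ℂ (tmul A B a b) (tmul A B a' b') = inner ℂ a a' * inner ℂ b b' :=
  TensorProduct.inner_tmul ℂ a a' b b'

theorem tensor_ext {A B : FdHilb} {V : Type*} [AddCommMonoid V] [Module ℂ V]
    {f g : tensor A B →ₗ[ℂ] V}
    (h : ∀ a b, f (tmul A B a b) = g (tmul A B a b)) : f = g :=
  TensorProduct.ext' h

@[simp]
theorem tensorMap_tmul {A A' B B' : FdHilb} (f : A →ₗ[ℂ] A') (g : B →ₗ[ℂ] B') (a : A) (b : B) :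
    tensorMap f g (tmul A B a b) = tmul A' B' (f a) (g b) :=
  TensorProduct.map_tmul f g a b

@[simp]
theorem tensorLift_tmul {A B C : FdHilb} (f : A →ₗ[ℂ] B →ₗ[ℂ] C) (a : A) (b : B) :
    tensorLift f (tmul A B a b) = f a b :=
  TensorProduct.lift.tmul a b

@[simp]
theorem tensorAssoc_tmul {A B C : FdHilb} (a : A) (b : B) (c : C) :
    tensorAssoc A B C (tmul (tensor A B) C (tmul A B a b) c) =
      tmul A (tensor B C) a (tmul B C b c) :=
  TensorProduct.assoc_tmul a b c

@[simp]
theorem tensorAssoc_symm_tmul {A B C : FdHilb} (a : A) (b : B) (c : C) :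
    (tensorAssoc A B C).symm (tmul A (tensor B C) a (tmul B C b c)) =
      tmul (tensor A B) C (tmul A B a b) c :=
  TensorProduct.assoc_symm_tmul a b c

/-- The functional `⟪x, ·⟫`, as a vector of the dual Hilbert space. -/
def bra (H : FdHilb) (x : H) : H.dual := InnerProductSpace.toDualMap ℂ H x

theorem inner_bra {H : FdHilb} (x y : H) : inner ℂ (bra H x) (bra H y) = inner ℂ y x := by
  have h (z : H) : (InnerProductSpace.toDual ℂ H).symm (InnerProductSpace.toDualMap ℂ H z) = z :=
    (InnerProductSpace.toDual ℂ H).symm_apply_apply z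
  change inner ℂ ((InnerProductSpace.toDual ℂ H).symm (InnerProductSpace.toDualMap ℂ H y))
    ((InnerProductSpace.toDual ℂ H).symm (InnerProductSpace.toDualMap ℂ H x)) = _
  rw [h, h]

theorem exists_bra {H : FdHilb} (f : H.dual) : ∃ x, bra H x = f :=
  ⟨(InnerProductSpace.toDual ℂ H).symm f, (InnerProductSpace.toDual ℂ H).apply_symm_apply f⟩

/-- The standard orthonormal basis of `H`. -/
abbrev onb (H : FdHilb) : OrthonormalBasis (Fin (Module.finrank ℂ H)) ℂ H :=
  stdOrthonormalBasis ℂ H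

/-- Conjugate linearity of `x ↦ ⟪x, ·⟫` turns the coefficients `⟪e_k, x⟫` of x into `⟪x, e_k⟫`. -/
theorem bra_eq_sum {H : FdHilb} (x : H) :
    bra H x = ∑ k, inner ℂ x (onb H k) • bra H (onb H k) := by
  conv_lhs => rw [← (onb H).sum_repr' x]
  simp only [bra, map_sum, LinearIsometry.map_smulₛₗ, inner_conj_symm]
  rfl

theorem bell_eq (H : FdHilb) :
    bell H = ∑ k, tmul H H.dual (onb H k) (bra H (onb H k)) := rfl

theorem bell'_eq (H : FdHilb) :
    bell' H = ∑ k, tmul H.dual H (bra H (onb H k)) (onb H k) := rfl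

variable (A : Fin n → FdHilb)

@[simp]
theorem proj_incl_same (j : Fin n) (x : A j) : proj A j (incl A j x) = x := by
  change (Pi.single j x : ∀ j, A j) j = x
  simp

theorem proj_incl_of_ne {j k : Fin n} (h : k ≠ j) (x : A j) : proj A k (incl A j x) = 0 := by
  change (Pi.single j x : ∀ j, A j) k = 0
  simp [h]

theorem sum_incl_proj (x : directSum A) : ∑ j, incl A j (proj A j x) = x := by
  change ∑ j, WithLp.toLp 2 (Pi.single j (WithLp.ofLp x j)) = x
  rw [← WithLp.toLp_sum, Finset.univ_sum_single]
  rfl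

theorem inner_eq_sum (x y : directSum A) :
    inner ℂ x y = ∑ j, inner ℂ (proj A j x) (proj A j y) :=
  PiLp.inner_apply (𝕜 := ℂ) (f := fun j => A j) x y

theorem inner_incl_left (j : Fin n) (x : A j) (y : directSum A) :
    inner ℂ (incl A j x) y = inner ℂ x (proj A j y) := by
  rw [inner_eq_sum, Finset.sum_eq_single j]
  · simp
  · intro k _ hk
    rw [proj_incl_of_ne A hk, inner_zero_left]
  · simp

end FdHilb

/-! ### Structural 2-cells evaluated on pure tensors. -/

section Composites

variable {F : Cell1 m n} {G : Cell1 n p} {K : Cell1 p q}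

/-- The pure tensor `x ⊗ y` in the `j`-th summand of an entry of a composite 1-cell. -/
def pure (F : Cell1 m n) (G : Cell1 n p) (i : Fin m) (k : Fin p) (j : Fin n) :
    F i j →ₗ[ℂ] G j k →ₗ[ℂ] comp F G i k :=
  (tmul (F i j) (G j k)).compr₂ (inclC F G i k j)

theorem inclC_tmul {i : Fin m} {k : Fin p} (j : Fin n) (x : F i j) (y : G j k) :
    inclC F G i k j (tmul _ _ x y) = pure F G i k j x y := rfl

theorem sum_inclC_projC {i : Fin m} {k : Fin p} (x : comp F G i k) :
    ∑ j, inclC F G i k j (projC F G i k j x) = x :=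
  sum_incl_proj _ x

theorem inner_inclC_left {i : Fin m} {k : Fin p} (j : Fin n) (x : tensor (F i j) (G j k))
    (y : comp F G i k) : inner ℂ (inclC F G i k j x) y = inner ℂ x (projC F G i k j y) :=
  inner_incl_left (fun j => tensor (F i j) (G j k)) j x y

/-- Pure tensors in the separate summands span each entry of a composite, so linear maps out of it
need only be compared there. -/
theorem comp_ext {V : Type*} [AddCommMonoid V] [Module ℂ V] {i : Fin m} {k : Fin p}
    {f g : comp F G i k →ₗ[ℂ] V}
    (h : ∀ j x y, f (pure F G i k j x y) = g (pure F G i k j x y)) : f = g := by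
  have h' (j : Fin n) : f ∘ₗ inclC F G i k j = g ∘ₗ inclC F G i k j := tensor_ext (h j)
  ext v
  rw [← sum_inclC_projC v, map_sum, map_sum]
  exact Finset.sum_congr rfl fun j _ => LinearMap.congr_fun (h' j) _

@[simp]
theorem projC_pure_same {i : Fin m} {k : Fin p} (j : Fin n) (x : F i j) (y : G j k) :
    projC F G i k j (pure F G i k j x y) = tmul _ _ x y :=
  proj_incl_same _ j _

theorem projC_pure_of_ne {i : Fin m} {k : Fin p} {j j' : Fin n} (h : j' ≠ j) (x : F i j)
    (y : G j k) : projC F G i k j' (pure F G i k j x y) = 0 :=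
  proj_incl_of_ne _ h _

theorem inner_pure_same {i : Fin m} {k : Fin p} (j : Fin n) (x x' : F i j) (y y' : G j k) :
    inner ℂ (pure F G i k j x y) (pure F G i k j x' y') = inner ℂ x x' * inner ℂ y y' := by
  rw [← inclC_tmul, inner_inclC_left, projC_pure_same, inner_tmul]

theorem inner_pure_of_ne {i : Fin m} {k : Fin p} {j j' : Fin n} (h : j ≠ j') (x : F i j)
    (y : G j k) (x' : F i j') (y' : G j' k) :
    inner ℂ (pure F G i k j x y) (pure F G i k j' x' y') = 0 := by
  rw [← inclC_tmul, inner_inclC_left, projC_pure_of_ne h, inner_zero_right]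

@[simp]
theorem hcomp_pure {F' : Cell1 m n} {G' : Cell1 n p} (α : Cell2 F F') (β : Cell2 G G')
    {i : Fin m} {k : Fin p} (j : Fin n) (x : F i j) (y : G j k) :
    hcomp α β i k (pure F G i k j x y) = pure F' G' i k j (α i j x) (β j k y) := by
  simp only [hcomp, LinearMap.sum_apply, LinearMap.comp_apply]
  rw [Finset.sum_eq_single j]
  · simp [inclC_tmul]
  · intro j' _ h
    rw [projC_pure_of_ne h, map_zero, map_zero]
  · simp

@[simp]
theorem wl_pure (F : Cell1 m n) {G' : Cell1 n p} (β : Cell2 G G')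
    {i : Fin m} {k : Fin p} (j : Fin n) (x : F i j) (y : G j k) :
    wl F β i k (pure F G i k j x y) = pure F G' i k j x (β j k y) :=
  hcomp_pure (id₂ F) β j x y

@[simp]
theorem wr_pure {F' : Cell1 m n} (α : Cell2 F F') (G : Cell1 n p)
    {i : Fin m} {k : Fin p} (j : Fin n) (x : F i j) (y : G j k) :
    wr α G i k (pure F G i k j x y) = pure F' G i k j (α i j x) y :=
  hcomp_pure α (id₂ G) j x y

@[simp]
theorem assoc_pure {i : Fin m} {l : Fin q} (j : Fin n) (k : Fin p)
    (x : F i j) (y : G j k) (z : K k l) :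
    assoc F G K i l (pure (comp F G) K i l k (pure F G i k j x y) z) =
      pure F (comp G K) i l j x (pure G K j l k y z) := by
  simp only [assoc, LinearMap.sum_apply, LinearMap.comp_apply]
  rw [Finset.sum_eq_single j, Finset.sum_eq_single k]
  · simp [inclC_tmul]
  · intro k' _ h
    simp [projC_pure_of_ne h]
  · simp
  · intro j' _ h
    refine Finset.sum_eq_zero fun k' _ => ?_
    -- The projection to the summand k' acts first; the inner projection to j' meets a pure tensor
    -- only when k' = k.
    by_cases hk : k' = k
    · subst hk
      simp [projC_pure_of_ne h]
    · simp [projC_pure_of_ne hk]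
  · simp

@[simp]
theorem assocInv_pure {i : Fin m} {l : Fin q} (j : Fin n) (k : Fin p)
    (x : F i j) (y : G j k) (z : K k l) :
    assocInv F G K i l (pure F (comp G K) i l j x (pure G K j l k y z)) =
      pure (comp F G) K i l k (pure F G i k j x y) z := by
  simp only [assocInv, LinearMap.sum_apply, LinearMap.comp_apply]
  rw [Finset.sum_eq_single j, Finset.sum_eq_single k]
  · simp [inclC_tmul]
  · intro k' _ h
    simp [projC_pure_of_ne h]
  · simp
  · intro j' _ h
    refine Finset.sum_eq_zero fun k' _ => ?_
    simp [projC_pure_of_ne h]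
  · simp

@[simp]
theorem vcomp_apply {F G K : Cell1 m n} (α : Cell2 F G) (β : Cell2 G K) (i : Fin m) (j : Fin n)
    (x : F i j) : vcomp α β i j x = β i j (α i j x) := rfl

@[simp]
theorem indicatorCoord_indicatorVec {P : Prop} [Decidable P] (h : P) :
    indicatorCoord h (indicatorVec h) = 1 := by
  change (EuclideanSpace.single (PLift.up h) (1 : ℂ)) (PLift.up h) = 1
  simp

@[simp]
theorem fromId_indicatorVec {F : Cell1 n n} (v : ∀ i, F i i) (i : Fin n) :
    fromId v i i (indicatorVec rfl) = v i := by
  simp [fromId]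

@[simp]
theorem leftUnitor_pure (F : Cell1 m n) (i : Fin m) (k : Fin n) (x : F i k) :
    leftUnitor F i k (pure (id₁ m) F i k i (indicatorVec rfl) x) = x := by
  simp [leftUnitor]

@[simp]
theorem leftUnitorInv_apply (F : Cell1 m n) (i : Fin m) (k : Fin n) (x : F i k) :
    leftUnitorInv F i k x = pure (id₁ m) F i k i (indicatorVec rfl) x := rfl

@[simp]
theorem rightUnitorInv_apply (F : Cell1 m n) (i : Fin m) (k : Fin n) (x : F i k) :
    rightUnitorInv F i k x = pure F (id₁ n) i k k x (indicatorVec rfl) := rfl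

theorem cup_indicatorVec (F : Cell1 m n) (i : Fin m) :
    cup F i i (indicatorVec rfl) =
      ∑ j, ∑ k, pure F (adj F) i i j (onb (F i j) k) (bra _ (onb (F i j) k)) := by
  simp only [cup, fromId_indicatorVec, bell_eq, map_sum]
  rfl

theorem cup'_indicatorVec (F : Cell1 m n) (j : Fin n) :
    cup' F j j (indicatorVec rfl) =
      ∑ i, ∑ k, pure (adj F) F j j i (bra _ (onb (F i j) k)) (onb (F i j) k) := by
  simp only [cup', fromId_indicatorVec, bell'_eq, map_sum]
  rfl

end Composites

/-! ### Unitary 2-cells and orthonormal bases of composites. -/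

section Unitarity

theorem isUnitary_iff {F G : Cell1 m n} (α : Cell2 F G) :
    IsUnitary α ↔ ∀ i j, LinearMap.adjoint (α i j) ∘ₗ α i j = LinearMap.id ∧
      α i j ∘ₗ LinearMap.adjoint (α i j) = LinearMap.id := by
  simp only [IsUnitary, funext_iff, vcomp, dagger, id₂, ← forall_and]

theorem isUnitary_iff_zero {F G : Cell1 1 1} (α : Cell2 F G) :
    IsUnitary α ↔ LinearMap.adjoint (α 0 0) ∘ₗ α 0 0 = LinearMap.id ∧
      α 0 0 ∘ₗ LinearMap.adjoint (α 0 0) = LinearMap.id := by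
  simp only [isUnitary_iff, Fin.forall_fin_one]

theorem IsUnitary.inner_map_map {F G : Cell1 m n} {α : Cell2 F G} (h : IsUnitary α) (i : Fin m)
    (j : Fin n) (x y : F i j) : inner ℂ (α i j x) (α i j y) = inner ℂ x y := by
  rw [← LinearMap.adjoint_inner_right, ← LinearMap.comp_apply, (((isUnitary_iff α).1 h) i j).1,
    LinearMap.id_apply]

theorem IsUnitary.dagger {F G : Cell1 m n} {α : Cell2 F G} (h : IsUnitary α) :
    IsUnitary (dagger α) := by
  rw [isUnitary_iff] at h ⊢
  intro i j
  simpa only [TwoHilb.dagger, LinearMap.adjoint_adjoint] using (h i j).symm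

theorem IsUnitary.vcomp {F G K : Cell1 m n} {α : Cell2 F G} {β : Cell2 G K} (hα : IsUnitary α)
    (hβ : IsUnitary β) : IsUnitary (vcomp α β) := by
  rw [isUnitary_iff] at hα hβ ⊢
  intro i j
  simp only [TwoHilb.vcomp, LinearMap.adjoint_comp]
  constructor
  · rw [LinearMap.comp_assoc, ← LinearMap.comp_assoc (α i j), (hβ i j).1, LinearMap.id_comp,
      (hα i j).1]
  · rw [LinearMap.comp_assoc, ← LinearMap.comp_assoc _ _ (α i j), (hα i j).2, LinearMap.id_comp,
      (hβ i j).2]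

theorem IsUnitary.smul {F G : Cell1 m n} {α : Cell2 F G} (hα : IsUnitary α) {z : ℂ}
    (hz : starRingEnd ℂ z * z = 1) : IsUnitary (z • α) := by
  rw [isUnitary_iff] at hα ⊢
  intro i j
  simp only [Pi.smul_apply, map_smulₛₗ, LinearMap.comp_smul, LinearMap.smul_comp, smul_smul,
    (hα i j).1, (hα i j).2, hz, mul_comm z, one_smul, and_self]

/-- A composite 1-cell through one-dimensional spaces has an orthonormal basis of pure tensors. -/
theorem exists_orthonormalBasis_pure {F : Cell1 m n} {G : Cell1 n p} {i : Fin m} {k : Fin p}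
    (a : ∀ j, F i j) (b : ∀ j, G j k) (ha : ∀ j, inner ℂ (a j) (a j) = 1)
    (hb : ∀ j, inner ℂ (b j) (b j) = 1) (ha' : ∀ j x, ∃ c : ℂ, c • a j = x)
    (hb' : ∀ j x, ∃ c : ℂ, c • b j = x) :
    ∃ B : OrthonormalBasis (Fin n) ℂ (comp F G i k), ∀ j, B j = pure F G i k j (a j) (b j) := by
  have ho : Orthonormal ℂ fun j => pure F G i k j (a j) (b j) := by
    rw [orthonormal_iff_ite]
    intro j j'
    split_ifs with h
    · subst h
      rw [inner_pure_same, ha, hb, one_mul]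
    · exact inner_pure_of_ne h _ _ _ _
  have hs : ⊤ ≤ Submodule.span ℂ (Set.range fun j => pure F G i k j (a j) (b j)) := by
    -- The family spans if the quotient map by its span vanishes, which can be tested on pure
    -- tensors.
    have hq : (Submodule.span ℂ (Set.range fun j => pure F G i k j (a j) (b j))).mkQ = 0 := by
      refine comp_ext fun j x y => ?_
      obtain ⟨c, rfl⟩ := ha' j x
      obtain ⟨d, rfl⟩ := hb' j y
      rw [LinearMap.zero_apply, Submodule.mkQ_apply, Submodule.Quotient.mk_eq_zero]
      rw [map_smul, map_smul, LinearMap.smul_apply]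
      exact Submodule.smul_mem _ _ (Submodule.smul_mem _ _ (Submodule.subset_span ⟨j, rfl⟩))
    rw [← Submodule.ker_mkQ (Submodule.span ℂ _), hq, LinearMap.ker_zero]
  exact ⟨OrthonormalBasis.mk ho hs, fun j => by rw [OrthonormalBasis.coe_mk]⟩

end Unitarity

/-! ### One-dimensional entries: witnesses and outcome bases. -/

section Scalars

theorem exists_smul_indicatorVec {P : Prop} [Decidable P] (h : P) (x : indicator P) :
    ∃ c : ℂ, c • indicatorVec h = x := by
  refine ⟨indicatorCoord h x, ?_⟩
  change (indicatorCoord h x) • (EuclideanSpace.single (PLift.up h) (1 : ℂ)) = x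
  refine PiLp.ext fun i => ?_
  obtain rfl : i = PLift.up h := Subsingleton.elim _ _
  simp
  rfl

theorem inner_indicatorVec {P : Prop} [Decidable P] (h : P) :
    inner ℂ (indicatorVec h) (indicatorVec h) = 1 := by
  change inner ℂ (EuclideanSpace.single (PLift.up h) (1 : ℂ))
    (EuclideanSpace.single (PLift.up h) (1 : ℂ)) = 1
  simp

theorem smul_unitVec (x : scalar) : ∃ c : ℂ, c • unitVec = x :=
  ⟨x, mul_one (M := ℂ) x⟩

theorem inner_unitVec : inner ℂ unitVec unitVec = 1 := by
  change inner ℂ (1 : ℂ) (1 : ℂ) = 1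
  simp

theorem scalar_ext {V : Type*} [AddCommMonoid V] [Module ℂ V] {f g : scalar →ₗ[ℂ] V}
    (h : f unitVec = g unitVec) : f = g := by
  refine LinearMap.ext fun x => ?_
  obtain ⟨c, rfl⟩ := smul_unitVec x
  rw [map_smul, map_smul, h]

theorem smul_bra_unitVec (x : scalar.dual) : ∃ c : ℂ, c • bra scalar unitVec = x := by
  obtain ⟨y, rfl⟩ := exists_bra x
  obtain ⟨c, rfl⟩ := smul_unitVec y
  exact ⟨starRingEnd ℂ c, ((InnerProductSpace.toDualMap ℂ scalar).map_smulₛₗ c unitVec).symm⟩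

/-- The pure tensor `1 ⊗ x` next to the right boundary of a region of classical data. -/
abbrev beside (i : Fin n) (G : Cell1 1 p) (k : Fin p) : G 0 k →ₗ[ℂ] comp (witnessR n) G i k :=
  pure (witnessR n) G i k 0 unitVec

theorem inner_beside (i : Fin n) (G : Cell1 1 p) (k : Fin p) (x y : G 0 k) :
    inner ℂ (beside i G k x) (beside i G k y) = inner ℂ x y := by
  rw [inner_pure_same, inner_unitVec, one_mul]

theorem beside_injective (i : Fin n) (G : Cell1 1 p) (k : Fin p) :
    Function.Injective (beside i G k) := by
  intro x y h
  rw [← sub_eq_zero, ← inner_self_eq_zero (𝕜 := ℂ), ← inner_beside i, map_sub, h, sub_self,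
    inner_zero_left]

/-- Scalar multiplication by vectors of the Hilbert space `ℂ`. -/
def scalarAction (V : FdHilb) : scalar →ₗ[ℂ] V →ₗ[ℂ] V := LinearMap.lsmul ℂ V

theorem scalarAction_unitVec {V : FdHilb} (x : V) : scalarAction V unitVec x = x :=
  one_smul ℂ x

/-- The inverse of `beside`. -/
def unbeside (i : Fin n) (G : Cell1 1 p) (k : Fin p) : comp (witnessR n) G i k →ₗ[ℂ] G 0 k :=
  tensorLift (scalarAction (G 0 k)) ∘ₗ projC (witnessR n) G i k 0

theorem unbeside_beside (i : Fin n) (G : Cell1 1 p) (k : Fin p) (x : G 0 k) :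
    unbeside i G k (beside i G k x) = x := by
  rw [unbeside, LinearMap.comp_apply, projC_pure_same, tensorLift_tmul,
    scalarAction_unitVec]

theorem beside_unbeside (i : Fin n) (G : Cell1 1 p) (k : Fin p) (x : comp (witnessR n) G i k) :
    beside i G k (unbeside i G k x) = x := by
  have h : beside i G k ∘ₗ unbeside i G k = LinearMap.id := by
    refine comp_ext fun j a y => ?_
    obtain rfl : j = 0 := Subsingleton.elim _ _
    obtain ⟨c, rfl⟩ := smul_unitVec a
    rw [map_smul, LinearMap.smul_apply, map_smul, map_smul]
    congr 1
    exact congrArg (beside i G k) (unbeside_beside i G k y)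
  exact LinearMap.congr_fun h x

theorem exists_outcomeBasis (n : ℕ) :
    ∃ B : OrthonormalBasis (Fin n) ℂ (comp (witnessL n) (witnessR n) 0 0),
      ∀ j, B j = pure (witnessL n) (witnessR n) 0 0 j unitVec unitVec :=
  exists_orthonormalBasis_pure _ _ (fun _ => inner_unitVec) (fun _ => inner_unitVec)
    (fun _ => smul_unitVec) (fun _ => smul_unitVec)

theorem exists_dualOutcomeBasis (n : ℕ) :
    ∃ B : OrthonormalBasis (Fin n) ℂ (comp (adj (witnessR n)) (witnessR n) 0 0),
      ∀ j, B j = pure (adj (witnessR n)) (witnessR n) 0 0 j (bra scalar unitVec) unitVec :=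
  exists_orthonormalBasis_pure _ _ (fun _ => (inner_bra _ _).trans inner_unitVec)
    (fun _ => inner_unitVec) (fun _ => smul_bra_unitVec) (fun _ => smul_unitVec)

/-- The standard orthonormal basis of outcomes of a measurement. -/
def outcome (n : ℕ) : OrthonormalBasis (Fin n) ℂ (comp (witnessL n) (witnessR n) 0 0) :=
  (exists_outcomeBasis n).choose

theorem outcome_apply (j : Fin n) :
    outcome n j = pure (witnessL n) (witnessR n) 0 0 j unitVec unitVec :=
  (exists_outcomeBasis n).choose_spec j

/-- The standard orthonormal basis of outcomes, with the left boundary dualised. -/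
def dualOutcome (n : ℕ) :
    OrthonormalBasis (Fin n) ℂ (comp (adj (witnessR n)) (witnessR n) 0 0) :=
  (exists_dualOutcomeBasis n).choose

theorem dualOutcome_apply (j : Fin n) :
    dualOutcome n j =
      pure (adj (witnessR n)) (witnessR n) 0 0 j (bra scalar unitVec) unitVec :=
  (exists_dualOutcomeBasis n).choose_spec j

end Scalars

/-! ### Branches of a controlled operation and their Bell vectors. -/

section Protocols

variable {H : FdHilb}

/-- The operation performed on the system by a controlled operation when the datum is `i`. -/
def branch (U : ControlledOp n H) (i : Fin n) : H →ₗ[ℂ] H :=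
  unbeside i (system H) 0 ∘ₗ U i 0 ∘ₗ beside i (system H) 0

theorem apply_beside (U : ControlledOp n H) (i : Fin n) (x : H) :
    U i 0 (beside i (system H) 0 x) = beside i (system H) 0 (branch U i x) :=
  (beside_unbeside i (system H) 0 _).symm

theorem branch_smul (c : ℂ) (U : ControlledOp n H) (i : Fin n) :
    branch (c • U) i = c • branch U i := by
  ext x
  simp [branch]

theorem IsUnitary.inner_branch {U : ControlledOp n H} (hU : IsUnitary U) (i : Fin n) (x y : H) :
    inner ℂ (branch U i x) (branch U i y) = inner ℂ x y := by
  rw [← inner_beside i (system H) 0, ← apply_beside, ← apply_beside, hU.inner_map_map,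
    inner_beside]

/-- The vector `(u ⊗ 1) Bell` of `H ⊗ H*`. -/
def bellOf (u : H →ₗ[ℂ] H) : comp (system H) (adj (system H)) 0 0 :=
  ∑ k, pure (system H) (adj (system H)) 0 0 0 (u (onb H k)) (bra H (onb H k))

theorem bellOf_smul (c : ℂ) (u : H →ₗ[ℂ] H) : bellOf (c • u) = c • bellOf u := by
  simp [bellOf, Finset.smul_sum]

theorem cup_system (H : FdHilb) : cup (system H) 0 0 (indicatorVec rfl) =
    ∑ k, pure (system H) (adj (system H)) 0 0 0 (onb H k) (bra H (onb H k)) := by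
  rw [cup_indicatorVec, Fin.sum_univ_one]

theorem cup'_system (H : FdHilb) : cup' (system H) 0 0 (indicatorVec rfl) =
    ∑ k, pure (adj (system H)) (system H) 0 0 0 (bra H (onb H k)) (onb H k) := by
  rw [cup'_indicatorVec, Fin.sum_univ_one]

/-- Orthonormality of the functionals `⟪e_k, ·⟫` leaves only the term k = l, so these inner products
recover the matrix of u. -/
theorem inner_bellOf_pure (u : H →ₗ[ℂ] H) (x : H) (l : Fin (Module.finrank ℂ H)) :
    inner ℂ (bellOf u)
      (pure (system H) (adj (system H)) 0 0 0 x (bra H (onb H l))) =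
      inner ℂ (u (onb H l)) x := by
  simp only [bellOf, sum_inner, inner_pure_same]
  rw [Finset.sum_eq_single l]
  · rw [inner_bra]
    simp
  · intro k _ hk
    rw [inner_bra, (onb H).inner_eq_zero hk.symm, mul_zero]
  · simp

/-- Each of the dim H vectors u e_k contributes norm 1. This value is what fixes the modulus of the
scalar in horizontal unitarity. -/
theorem inner_bellOf_self {u : H →ₗ[ℂ] H} (hu : ∀ x y, inner ℂ (u x) (u y) = inner ℂ x y) :
    inner ℂ (bellOf u) (bellOf u) = (Module.finrank ℂ H : ℂ) := by
  -- Both arguments are unfolded but only the second sum is expanded; the first is then folded back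
  -- so that `inner_bellOf_pure` applies.
  conv_lhs => rw [bellOf.eq_1 u, inner_sum]
  rw [← bellOf]
  simp only [inner_bellOf_pure, hu, OrthonormalBasis.inner_eq_one, Finset.sum_const,
    Finset.card_univ, Fintype.card_fin, nsmul_eq_mul, mul_one]

/-! ### The protocols and the bend on basis vectors. -/

theorem denseCodingProtocol_apply (M : BipartiteMeasurement n H) (U : ControlledOp n H)
    (i : Fin n) : denseCodingProtocol M U i 0 unitVec =
      beside i (comp (witnessL n) (witnessR n)) 0 (M 0 0 (bellOf (branch U i))) := by
  simp only [denseCodingProtocol, vcomp_apply, rightUnitorInv_apply, wl_pure, cup_system,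
    map_sum, assocInv_pure, wr_pure, bellOf]
  refine Finset.sum_congr rfl fun k _ => ?_
  rw [apply_beside, assoc_pure, wl_pure]

theorem copyWitness_apply (i : Fin n) :
    copyWitness n i 0 unitVec =
      beside i (comp (witnessL n) (witnessR n)) 0 (outcome n i) := by
  simp only [copyWitness, vcomp_apply, leftUnitorInv_apply, wr_pure, copy, fromId_indicatorVec,
    inclC_tmul, assoc_pure, outcome_apply]

theorem denseCoding_iff (M : BipartiteMeasurement n H) (U : ControlledOp n H) :
    bellFactor H • denseCodingProtocol M U = copyWitness n ↔
      ∀ i, bellFactor H • M 0 0 (bellOf (branch U i)) = outcome n i := by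
  constructor
  · intro h i
    apply beside_injective i (comp (witnessL n) (witnessR n)) 0
    rw [map_smul, ← denseCodingProtocol_apply, ← copyWitness_apply, ← h]
    rfl
  · intro h
    funext i k
    obtain rfl : k = 0 := Subsingleton.elim _ _
    refine scalar_ext ?_
    rw [copyWitness_apply, ← h, map_smul, ← denseCodingProtocol_apply]
    rfl

/-- The cap is the adjoint of a cup, so its value is found by pairing with the cup; only the j-th
summand survives. -/
theorem cap_dualOutcome (j : Fin n) :
    cap (witnessR n) 0 0 (dualOutcome n j) = indicatorVec rfl := by
  refine ext_inner_right ℂ fun v => ?_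
  obtain ⟨c, rfl⟩ := exists_smul_indicatorVec rfl v
  rw [inner_smul_right, inner_smul_right, inner_indicatorVec]
  congr 1
  refine (LinearMap.adjoint_inner_left (cup' (witnessR n) 0 0) _ _).trans ?_
  rw [cup'_indicatorVec, inner_sum, Finset.sum_eq_single j]
  · simp only [inner_sum, dualOutcome_apply, inner_pure_same, inner_bra]
    -- The basis chosen for ℂ need not be the unit vector, so the remaining sum is evaluated by
    -- Parseval.
    rw [← inner_unitVec, ← (onb scalar).sum_inner_mul_inner unitVec unitVec]
    exact Finset.sum_congr rfl fun k _ => mul_comm _ _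
  · intro i _ h
    simp only [inner_sum, dualOutcome_apply]
    exact Finset.sum_eq_zero fun k _ => inner_pure_of_ne h.symm _ _ _ _
  · simp

/-- The cup supplies Bell, U acts on its left half by the j-th branch, and the cap removes the two
witnesses with factor 1. -/
theorem bend_dualOutcome (U : ControlledOp n H) (j : Fin n) :
    bend (F := witnessR n) (G := system H) (H := witnessR n) (J := system H) U 0 0
      (dualOutcome n j) = bellOf (branch U j) := by
  simp only [bend, vcomp_apply, rightUnitorInv_apply, wl_pure, cup_system, map_sum, bellOf]
  refine Finset.sum_congr rfl fun k _ => ?_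
  rw [dualOutcome_apply, assoc_pure, wl_pure, assocInv_pure, wl_pure, wr_pure, apply_beside,
    wl_pure, assoc_pure, assocInv_pure, wr_pure, ← dualOutcome_apply, cap_dualOutcome,
    leftUnitor_pure]

theorem teleportationProtocol_apply (M : BipartiteMeasurement n H) (U : ControlledOp n H)
    (x : H) : teleportationProtocol M U 0 0 x =
      ∑ j, pure (witnessL n) (comp (witnessR n) (system H)) 0 0 j unitVec
        (beside j (system H) 0 (∑ k, inner ℂ (LinearMap.adjoint (M 0 0) (outcome n j))
          (pure (system H) (adj (system H)) 0 0 0 x (bra H (onb H k))) •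
            branch U j (onb H k))) := by
  simp only [teleportationProtocol, vcomp_apply, rightUnitorInv_apply, wl_pure, cup'_system,
    map_sum, assocInv_pure, wr_pure]
  rw [Finset.sum_comm]
  refine Finset.sum_congr rfl fun k _ => ?_
  -- Expanding the measured vector over the outcomes exposes which branch of U acts.
  conv_lhs => rw [← (outcome n).sum_repr' (M 0 0 _)]
  simp only [map_sum, LinearMap.sum_apply, map_smul, LinearMap.smul_apply]
  refine Finset.sum_congr rfl fun j _ => ?_
  rw [outcome_apply, assoc_pure, wl_pure, apply_beside, LinearMap.adjoint_inner_left]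

theorem createBeside_apply (x : H) : createBeside n H 0 0 x =
      ∑ j, pure (witnessL n) (comp (witnessR n) (system H)) 0 0 j unitVec
        (beside j (system H) 0 x) := by
  simp only [createBeside, vcomp_apply, leftUnitorInv_apply, wr_pure, create,
    fromId_indicatorVec, inclC_tmul, map_sum, LinearMap.sum_apply, assoc_pure]

theorem inner_pure_sum_pure (y : Fin n → H) (j : Fin n) (w : H) :
    inner ℂ (pure (witnessL n) (comp (witnessR n) (system H)) 0 0 j unitVec
        (beside j (system H) 0 w))
      (∑ i, pure (witnessL n) (comp (witnessR n) (system H)) 0 0 i unitVec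
        (beside i (system H) 0 (y i))) = inner ℂ w (y j) := by
  rw [inner_sum, Finset.sum_eq_single j]
  · rw [inner_pure_same, inner_unitVec, one_mul, inner_beside]
  · exact fun i _ h => inner_pure_of_ne h.symm _ _ _ _
  · simp

theorem sum_pure_injective {y z : Fin n → H}
    (h : ∑ i, pure (witnessL n) (comp (witnessR n) (system H)) 0 0 i unitVec
        (beside i (system H) 0 (y i)) =
      ∑ i, pure (witnessL n) (comp (witnessR n) (system H)) 0 0 i unitVec
        (beside i (system H) 0 (z i))) (j : Fin n) : y j = z j := by
  refine ext_inner_left ℂ fun w => ?_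
  rw [← inner_pure_sum_pure, h, inner_pure_sum_pure]

theorem teleportation_iff (M : BipartiteMeasurement n H) (U : ControlledOp n H) :
    teleportationProtocol M U = bellFactor H • createBeside n H ↔
      ∀ j x, ∑ k, inner ℂ (LinearMap.adjoint (M 0 0) (outcome n j))
          (pure (system H) (adj (system H)) 0 0 0 x (bra H (onb H k))) •
            branch U j (onb H k) = bellFactor H • x := by
  have hc (x : H) : (bellFactor H • createBeside n H) 0 0 x =
      ∑ j, pure (witnessL n) (comp (witnessR n) (system H)) 0 0 j unitVec
        (beside j (system H) 0 (bellFactor H • x)) := by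
    simp only [map_smul, ← Finset.smul_sum]
    rw [← createBeside_apply]
    rfl
  constructor
  · intro h j x
    refine sum_pure_injective (y := fun j =>
      ∑ k, inner ℂ (LinearMap.adjoint (M 0 0) (outcome n j))
        (pure (system H) (adj (system H)) 0 0 0 x (bra H (onb H k))) • branch U j (onb H k))
      (z := fun _ => bellFactor H • x) ?_ j
    rw [← teleportationProtocol_apply, h, hc]
  · intro h
    funext i k
    obtain rfl : i = 0 := Subsingleton.elim _ _
    obtain rfl : k = 0 := Subsingleton.elim _ _
    refine LinearMap.ext fun x => ?_
    rw [teleportationProtocol_apply, hc]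
    simp only [h]

/-- The operation `u` undoes the effect of measuring against `v`, up to the factor `b`, exactly if
`v` is `b` times the Bell vector of `u`. -/
theorem sum_inner_smul_eq_iff {u : H →ₗ[ℂ] H} (hu : ∀ x y, inner ℂ (u x) (u y) = inner ℂ x y)
    (b : ℂ) (hb : starRingEnd ℂ b = b) (v : comp (system H) (adj (system H)) 0 0) :
    (∀ x, ∑ k, inner ℂ v (pure (system H) (adj (system H)) 0 0 0 x (bra H (onb H k))) •
        u (onb H k) = b • x) ↔ b • bellOf u = v := by
  have hu' : Orthonormal ℂ fun k => u (onb H k) := by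
    rw [orthonormal_iff_ite]
    intro k l
    rw [hu, (orthonormal_iff_ite.1 (onb H).orthonormal)]
  -- An isometry of a finite-dimensional space carries an orthonormal basis to an orthonormal basis,
  -- by counting.
  let B : OrthonormalBasis (Fin (Module.finrank ℂ H)) ℂ H :=
    OrthonormalBasis.mk hu' (hu'.linearIndependent.span_eq_top_of_card_eq_finrank' (by simp)).ge
  have hB (k : Fin (Module.finrank ℂ H)) : u (onb H k) = B k := by simp [B]
  constructor
  · intro h
    refine ext_inner_right ℂ fun w => ?_
    have hl : innerₛₗ ℂ (b • bellOf u) = innerₛₗ ℂ v := by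
      refine comp_ext fun j x f => ?_
      obtain rfl : j = 0 := Subsingleton.elim _ _
      obtain ⟨y, rfl⟩ := exists_bra f
      rw [bra_eq_sum]
      simp only [map_sum, map_smul]
      refine Finset.sum_congr rfl fun l _ => congrArg _ ?_
      -- Pairing the hypothesis at x with u e_l isolates the l-th coefficient. The scalar b leaves
      -- the left slot conjugated, hence the need for b real.
      rw [innerₛₗ_apply_apply, innerₛₗ_apply_apply, inner_smul_left, inner_bellOf_pure, hb,
        ← inner_smul_right, ← h x, inner_sum]
      simp only [inner_smul_right, hu]
      rw [Finset.sum_eq_single l]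
      · simp
      · intro k _ hk
        rw [(onb H).inner_eq_zero hk.symm, mul_zero]
      · simp
    exact LinearMap.congr_fun hl w
  · rintro rfl x
    simp only [inner_smul_left, inner_bellOf_pure, hb, mul_smul, ← Finset.smul_sum]
    simp only [hB]
    rw [B.sum_repr']

/-! ### The two equivalences. -/

theorem conj_bellFactor (H : FdHilb) : starRingEnd ℂ (bellFactor H) = bellFactor H :=
  Complex.conj_ofReal _

theorem IsUnitary.apply_eq_iff {F G : Cell1 1 1} {α : Cell2 F G} (h : IsUnitary α) (x : F 0 0)
    (y : G 0 0) : α 0 0 x = y ↔ x = LinearMap.adjoint (α 0 0) y := by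
  rw [isUnitary_iff_zero] at h
  constructor
  · rintro rfl
    exact (LinearMap.congr_fun h.1 x).symm
  · rintro rfl
    exact LinearMap.congr_fun h.2 y

/-- For each outcome both equations say that b β_j is the preimage of that outcome under M. -/
theorem solvesTeleportation_iff_solvesDenseCoding {U : ControlledOp n H} (hU : IsUnitary U)
    (M : BipartiteMeasurement n H) : SolvesTeleportation M U ↔ SolvesDenseCoding M U := by
  refine and_congr_right fun hM => and_congr_right fun _ => ?_
  rw [teleportation_iff, denseCoding_iff]
  refine forall_congr' fun j => ?_
  rw [sum_inner_smul_eq_iff (hU.inner_branch j) _ (conj_bellFactor H), ← hM.apply_eq_iff,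
    map_smul]

/-- The unitary matching the two bases of outcomes. -/
def undualise (n : ℕ) : comp (adj (witnessR n)) (witnessR n) 0 0 ≃ₗᵢ[ℂ]
    comp (witnessL n) (witnessR n) 0 0 :=
  (dualOutcome n).equiv (outcome n) (Equiv.refl _)

theorem undualise_dualOutcome (j : Fin n) : undualise n (dualOutcome n j) = outcome n j := by
  simp [undualise]

/-- The 2-cell given by `undualise`. -/
def undualiseCell (n : ℕ) :
    Cell2 (comp (adj (witnessR n)) (witnessR n)) (comp (witnessL n) (witnessR n)) :=
  fun i k => by
    exact match i, k with
    | 0, 0 => (undualise n).toLinearEquiv.toLinearMap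

theorem undualiseCell_dualOutcome (j : Fin n) :
    undualiseCell n 0 0 (dualOutcome n j) = outcome n j :=
  undualise_dualOutcome j

theorem isUnitary_undualiseCell (n : ℕ) : IsUnitary (undualiseCell n) := by
  have h : LinearMap.adjoint (undualiseCell n 0 0) ∘ₗ undualiseCell n 0 0 = LinearMap.id := by
    refine LinearMap.ext fun x => ext_inner_right ℂ fun y => ?_
    rw [LinearMap.comp_apply, LinearMap.adjoint_inner_left]
    exact (undualise n).inner_map_map x y
  refine (isUnitary_iff_zero _).2 ⟨h, LinearMap.ext fun x => ?_⟩
  obtain ⟨y, rfl⟩ := (undualise n).surjective x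
  exact congrArg (undualiseCell n 0 0) (LinearMap.congr_fun h y)

theorem cell2_ext_dualOutcome {G : Cell1 1 1}
    {α β : Cell2 (comp (adj (witnessR n)) (witnessR n)) G}
    (h : ∀ j, α 0 0 (dualOutcome n j) = β 0 0 (dualOutcome n j)) : α = β := by
  funext i k
  obtain rfl : i = 0 := Subsingleton.elim _ _
  obtain rfl : k = 0 := Subsingleton.elim _ _
  exact (dualOutcome n).toBasis.ext fun j => by simpa using h j

/-- The scaled Bell vectors are the preimages of the outcomes under M, so the bend is M† after a
matching of outcome bases. -/
theorem isHorizontallyUnitary_of_solvesDenseCoding {M : BipartiteMeasurement n H}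
    {U : ControlledOp n H} (h : SolvesDenseCoding M U) :
    ∃ c : ℂ, c ≠ 0 ∧ IsHorizontallyUnitary (c • U) := by
  obtain ⟨hM, -, h⟩ := h
  rw [denseCoding_iff] at h
  obtain ⟨c, hc, hcb⟩ : ∃ c : ℂ, c ≠ 0 ∧ ∀ i, c • M 0 0 (bellOf (branch U i)) = outcome n i := by
    -- `bellFactor H` is 0 when dim H = 0, by division by zero. An outcome would then be the zero
    -- vector, so there are none and any nonzero c works.
    by_cases hb : bellFactor H = 0
    · refine ⟨1, one_ne_zero, fun i => absurd (h i) ?_⟩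
      rw [hb, zero_smul]
      exact ((outcome n).orthonormal.ne_zero i).symm
    · exact ⟨_, hb, h⟩
  refine ⟨c, hc, ?_⟩
  have hbend : bend (F := witnessR n) (G := system H) (H := witnessR n) (J := system H) (c • U) =
      vcomp (undualiseCell n) (dagger M) := by
    refine cell2_ext_dualOutcome fun j => ?_
    rw [bend_dualOutcome, vcomp_apply, undualiseCell_dualOutcome, branch_smul, bellOf_smul]
    refine (hM.apply_eq_iff _ _).1 ?_
    rw [map_smul, hcb]
  unfold IsHorizontallyUnitary
  rw [hbend]
  exact (isUnitary_undualiseCell n).vcomp hM.dagger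

/-- The bend preserves the norm of a basis vector, so |c|² dim H = 1 and c differs from 1/√(dim H)
by a phase. Without outcomes nothing constrains c, hence the nonemptiness clause. -/
theorem exists_phase {U : ControlledOp n H} (hU : IsUnitary U) {c : ℂ}
    (h : IsHorizontallyUnitary (c • U)) :
    ∃ z : ℂ, starRingEnd ℂ z * z = 1 ∧ (Nonempty (Fin n) → bellFactor H * z = c) := by
  rcases isEmpty_or_nonempty (Fin n) with hn | ⟨⟨i⟩⟩
  · exact ⟨1, by simp, fun hn' => absurd hn' (not_nonempty_iff.2 hn)⟩
  have hi := h.inner_map_map 0 0 (dualOutcome n i) (dualOutcome n i)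
  rw [bend_dualOutcome, branch_smul, bellOf_smul, inner_smul_left, inner_smul_right,
    inner_bellOf_self (hU.inner_branch i), (dualOutcome n).inner_eq_one] at hi
  have hd : (Module.finrank ℂ H : ℂ) ≠ 0 := by
    intro hd
    simp [hd] at hi
  set s : ℂ := (Real.sqrt (Module.finrank ℂ H) : ℂ) with hs
  have hss : s * s = (Module.finrank ℂ H : ℂ) := by
    rw [hs, ← Complex.ofReal_mul, Real.mul_self_sqrt (Nat.cast_nonneg _), Complex.ofReal_natCast]
  have hs0 : s ≠ 0 := by
    rintro h0
    rw [h0, zero_mul] at hss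
    exact hd hss.symm
  have hb : bellFactor H * s = 1 := by
    rw [bellFactor, Complex.ofReal_div, Complex.ofReal_one, ← hs, one_div, inv_mul_cancel₀ hs0]
  -- The phase is c√(dim H).
  refine ⟨c * s, ?_, fun _ => by rw [mul_left_comm, hb, mul_one]⟩
  rw [map_mul, hs, Complex.conj_ofReal, ← hs, ← hi, ← hss]
  ring

theorem exists_solvesDenseCoding {U : ControlledOp n H} (hU : IsUnitary U) {c : ℂ}
    (h : IsHorizontallyUnitary (c • U)) :
    ∃ M : BipartiteMeasurement n H, SolvesDenseCoding M U := by
  obtain ⟨z, hz, hzc⟩ := exists_phase hU h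
  -- The adjoint of the bend sends c β_i to the i-th basis vector; the phase z makes the factor b z
  -- equal to c.
  refine ⟨z • vcomp (dagger (bend (c • U))) (undualiseCell n),
    (h.dagger.vcomp (isUnitary_undualiseCell n)).smul hz, hU, ?_⟩
  rw [denseCoding_iff]
  intro i
  have hi : LinearMap.adjoint (bend (F := witnessR n) (G := system H) (H := witnessR n)
      (J := system H) (c • U) 0 0) (c • bellOf (branch U i)) = dualOutcome n i := by
    refine ((h.apply_eq_iff _ _).1 ?_).symm
    rw [bend_dualOutcome, branch_smul, bellOf_smul]
  change bellFactor H • z • undualiseCell n 0 0 (LinearMap.adjoint (bend (F := witnessR n)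
    (G := system H) (H := witnessR n) (J := system H) (c • U) 0 0) (bellOf (branch U i))) = _
  rw [smul_smul, hzc ⟨i⟩, ← map_smul, ← map_smul, hi, undualiseCell_dualOutcome]

end Protocols

end TwoHilb

end

theorem mainTheorem3 (n : ℕ) (H : TwoHilb.FdHilb) (U : TwoHilb.ControlledOp n H)
    (hU : TwoHilb.IsUnitary U) :
    ((∃ M : TwoHilb.BipartiteMeasurement n H, TwoHilb.SolvesDenseCoding M U) ↔
      ∃ c : ℂ, c ≠ 0 ∧ TwoHilb.IsHorizontallyUnitary (c • U)) ∧
    (∀ M : TwoHilb.BipartiteMeasurement n H,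
      TwoHilb.SolvesTeleportation M U ↔ TwoHilb.SolvesDenseCoding M U) :=
  ⟨⟨fun ⟨_, hM⟩ => TwoHilb.isHorizontallyUnitary_of_solvesDenseCoding hM,
    fun ⟨_, _, hc⟩ => TwoHilb.exists_solvesDenseCoding hU hc⟩,
    TwoHilb.solvesTeleportation_iff_solvesDenseCoding hU⟩
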